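/- A *notion of sufficiently fast-growing sequences of Turing degrees* is a function $f$ that maps each countable sequence $S$ of Turing degrees (a function from a countable ordinal $|S|$ to the Turing degrees) to a nonempty upwards-closed set $f(S)$ of Turing degrees (the permissible next elements). Call $S$ *$f$-admissible* if $S(\alpha)\in f(S|\alpha)$ for all $\alpha<|S|$. For a set $x$, let $L_0(x)$ be the transitive closure of $\{x\}$, let $L_{\alpha+1}(x)$ be the set of subsets of $L_\alpha(x)$ that are first-order definable over $(L_\alpha(x),\in)$ with parameters, and take unions at limits. Let $\mathrm{ZF}\setminus\mathrm{P}$ be ZF without the power set axiom. **Proposition 2.** For every notion $g$ of sufficiently fast-growing sequences of Turing degrees there is a notion $f$ that is stricter, i.e. $f(S)\subseteq g(S)$ for every countable sequence $S$ of Turing degrees, such that: (1) for successor $|S|$ and $f$-admissible $S$, $f(S)$ depends only on the last element of $S$: if $S$ and $T$ are $f$-admissible sequences of (possibly different) successor lengths with the same last element, then $f(S)=f(T)$; (2) (strong monotonicity) for every countable sequence $S$ of Turing degrees there is a least ordinal $\delta$ with $L_\delta(S)\models \mathrm{ZF}\setminus\mathrm{P}$, and for every countable sequence $T$ of Turing degrees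 with $T\in L_\delta(S)$, $f(S)\subseteq f(T)$. -/

import Mathlib

open scoped Ordinal

noncomputable section

namespace FastGrowing

/-! ### Turing degrees of reals (subsets of `ℕ`) -/

/-- The characteristic function of a set of natural numbers, as an oracle. -/
def charFun (A : Set ℕ) : ℕ →. ℕ :=
  ((A.indicator (fun _ => 1) : ℕ → ℕ) : ℕ →. ℕ)

/-- `A` is Turing reducible to `B`. -/
def Reducible (A B : Set ℕ) : Prop :=
  TuringReducible (charFun A) (charFun B)

theorem Reducible.refl (A : Set ℕ) : Reducible A A :=
  TuringReducible.refl _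

theorem Reducible.trans {A B C : Set ℕ} (h : Reducible A B) (h' : Reducible B C) :
    Reducible A C :=
  TuringReducible.trans h h'

/-- Turing equivalence of sets of natural numbers. -/
def turingSetoid : Setoid (Set ℕ) where
  r A B := Reducible A B ∧ Reducible B A
  iseqv :=
    { refl := fun A => ⟨Reducible.refl A, Reducible.refl A⟩
      symm := fun h => ⟨h.2, h.1⟩
      trans := fun h h' => ⟨h.1.trans h'.1, h'.2.trans h.2⟩ }

/-- A Turing degree: an equivalence class of sets of natural numbers under Turing equivalence. -/
def Degree : Type :=
  Quotient turingSetoid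

/-- The Turing degree of a set of natural numbers. -/
def Degree.of (A : Set ℕ) : Degree :=
  Quotient.mk turingSetoid A

/-- The Turing degrees, partially ordered by Turing reducibility. -/
instance : PartialOrder Degree where
  le d e := Quotient.liftOn₂ d e Reducible fun _ _ _ _ hA hB =>
    propext ⟨fun h => hA.2.trans (h.trans hB.1), fun h => hA.1.trans (h.trans hB.2)⟩
  le_refl d := Quotient.inductionOn d Reducible.refl
  le_trans d e k := Quotient.inductionOn₃ d e k fun _ _ _ h h' => Reducible.trans h h'
  le_antisymm d e := Quotient.inductionOn₂ d e fun _ _ h h' => Quotient.sound ⟨h, h'⟩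

theorem Degree.of_le_of {A B : Set ℕ} : Degree.of A ≤ Degree.of B ↔ Reducible A B :=
  Iff.rfl

/-! ### Countable sequences of Turing degrees -/

/-- A countable sequence of Turing degrees: its length is an ordinal below `ω₁`. -/
structure DegSeq where
  /-- The length `|S|`. -/
  length : Ordinal.{0}
  length_lt : length < ω₁
  /-- The term `S(α)`, for `α < |S|`. -/
  term : Set.Iio length → Degree

/-- The initial segment `S|α`. -/
def DegSeq.restrict (S : DegSeq) (α : Ordinal.{0}) (h : α ≤ S.length) : DegSeq where
  length := α
  length_lt := h.trans_lt S.length_lt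
  term i := S.term ⟨i.1, lt_of_lt_of_le i.2 h⟩

/-- `S` has successor length, and its last element is `d`. -/
def DegSeq.HasLast (S : DegSeq) (d : Degree) : Prop :=
  ∃ (β : Ordinal.{0}) (h : β < S.length), S.length = β + 1 ∧ S.term ⟨β, h⟩ = d

/-- A notion of sufficiently fast-growing sequences of Turing degrees: it maps each countable
sequence of degrees to a nonempty upwards-closed set of degrees, the permissible next elements. -/
structure FastNotion where
  next : DegSeq → Set Degree
  nonempty : ∀ S, (next S).Nonempty
  isUpperSet : ∀ S, IsUpperSet (next S)

/-- Every element of `S` is permissible: `S(α) ∈ f(S|α)` for all `α < |S|`. -/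
def FastNotion.Admissible (f : FastNotion) (S : DegSeq) : Prop :=
  ∀ (α : Ordinal.{0}) (h : α < S.length), S.term ⟨α, h⟩ ∈ f.next (S.restrict α h.le)

/-- `f` is stricter than (or equal to) `g`. -/
def FastNotion.Stricter (f g : FastNotion) : Prop :=
  ∀ S, f.next S ⊆ g.next S

/-! ### Sequences of degrees as sets -/

/-- A set of natural numbers as a set of finite von Neumann ordinals. -/
def realSet (A : Set ℕ) : ZFSet.{0} :=
  ZFSet.range fun n : A => Ordinal.toZFSet ((n : ℕ) : Ordinal.{0})

/-- A Turing degree as the set of the reals in it. -/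
def degreeSet (d : Degree) : ZFSet.{0} :=
  ZFSet.range fun A : {A : Set ℕ // Degree.of A = d} => realSet A.1

/-- A sequence of Turing degrees as a function on a von Neumann ordinal, that is, as the set of
the pairs `(α, S(α))` for `α < |S|`. -/
def DegSeq.toSet (S : DegSeq) : ZFSet.{0} :=
  ZFSet.range fun i : Set.Iio S.length =>
    ZFSet.pair (Ordinal.toZFSet i.1) (degreeSet (S.term i))

/-! ### The language of set theory and the constructible hierarchy over a set -/

/-- The relation symbols of the language of set theory: just the binary symbol `∈`. -/
inductive MemRel : ℕ → Type
  | mem : MemRel 2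

/-- The first-order language of set theory. -/
def memLang : FirstOrder.Language where
  Functions _ := Empty
  Relations := MemRel

/-- A set `M`, as a structure for the language of set theory with the true membership relation. -/
instance memStructure (M : ZFSet.{0}) : memLang.Structure M where
  funMap := fun F => Empty.elim F
  RelMap := fun R => match R with
    | MemRel.mem => fun v => (v 0).1 ∈ (v 1).1

/-- `Def(M)`: the set of the subsets of `M` that are first-order definable over `(M, ∈)` with
parameters from `M`. -/
def definablePowerset (M : ZFSet.{0}) : ZFSet.{0} :=
  ZFSet.sep (fun x => (Set.univ : Set M).Definable₁ memLang {y : M | y.1 ∈ x}) (ZFSet.powerset M)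

/-- The transitive closure of `{x}`: everything that is reached from `x` by going down along
membership finitely often. The von Neumann level only bounds the set. -/
def trclSingleton (x : ZFSet.{0}) : ZFSet.{0} :=
  ZFSet.sep (fun y => Relation.ReflTransGen (fun a b : ZFSet.{0} => a ∈ b) y x)
    (ZFSet.vonNeumann (Order.succ (ZFSet.rank x)))

theorem mem_trclSingleton {x y : ZFSet.{0}} :
    y ∈ trclSingleton x ↔ Relation.ReflTransGen (fun a b : ZFSet.{0} => a ∈ b) y x := by
  rw [trclSingleton, ZFSet.mem_sep, and_iff_right_iff_imp]
  intro h
  rw [ZFSet.mem_vonNeumann, Order.lt_succ_iff]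
  induction h using Relation.ReflTransGen.head_induction_on with
  | refl => exact le_rfl
  | head hab _ ih => exact (ZFSet.rank_lt_of_mem hab).le.trans ih

/-- The constructible hierarchy over `x`: `L_0(x)` is the transitive closure of `{x}`,
`L_{α+1}(x) = Def(L_α(x))`, and unions are taken at limits. -/
def LOver (x : ZFSet.{0}) (α : Ordinal.{0}) : ZFSet.{0} :=
  Ordinal.limitRecOn α (trclSingleton x) (fun _ Lβ => definablePowerset Lβ)
    (fun l _ L => ZFSet.iUnion fun β : Set.Iio l => L β.1 β.2)

theorem LOver_zero (x : ZFSet.{0}) : LOver x 0 = trclSingleton x :=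
  Ordinal.limitRecOn_zero ..

theorem LOver_add_one (x : ZFSet.{0}) (α : Ordinal.{0}) :
    LOver x (α + 1) = definablePowerset (LOver x α) :=
  Ordinal.limitRecOn_add_one ..

theorem LOver_limit (x : ZFSet.{0}) {l : Ordinal.{0}} (hl : Order.IsSuccLimit l) :
    LOver x l = ZFSet.iUnion fun β : Set.Iio l => LOver x β.1 :=
  Ordinal.limitRecOn_limit _ _ _ _ hl

/-- `(M, ∈)` satisfies ZF without the power set axiom. The variables range over `M`; the two
schemas are instantiated by all first-order formulas with parameters from `M`. -/
structure ModelsZFMinusP (M : ZFSet.{0}) : Prop where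
  extensionality : ∀ x y : M, (∀ z : M, z.1 ∈ x.1 ↔ z.1 ∈ y.1) → x = y
  foundation : ∀ x : M, (∃ y : M, y.1 ∈ x.1) →
    ∃ y : M, y.1 ∈ x.1 ∧ ∀ z : M, z.1 ∈ x.1 → z.1 ∉ y.1
  pairing : ∀ x y : M, ∃ p : M, ∀ z : M, z.1 ∈ p.1 ↔ z = x ∨ z = y
  union : ∀ x : M, ∃ u : M, ∀ z : M, z.1 ∈ u.1 ↔ ∃ y : M, y.1 ∈ x.1 ∧ z.1 ∈ y.1
  infinity : ∃ x : M, (∃ e : M, e.1 ∈ x.1 ∧ ∀ z : M, z.1 ∉ e.1) ∧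
    ∀ y : M, y.1 ∈ x.1 → ∃ s : M, s.1 ∈ x.1 ∧ ∀ z : M, z.1 ∈ s.1 ↔ z.1 ∈ y.1 ∨ z = y
  separation : ∀ D : Set M, (Set.univ : Set M).Definable₁ memLang D →
    ∀ a : M, ∃ b : M, ∀ x : M, x.1 ∈ b.1 ↔ x.1 ∈ a.1 ∧ x ∈ D
  replacement : ∀ F : Set (M × M), (Set.univ : Set M).Definable₂ memLang F →
    ∀ a : M, (∀ x : M, x.1 ∈ a.1 → ∀ y z : M, (x, y) ∈ F → (x, z) ∈ F → y = z) →
      ∃ b : M, ∀ y : M, y.1 ∈ b.1 ↔ ∃ x : M, x.1 ∈ a.1 ∧ (x, y) ∈ F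

end FastGrowing

end

noncomputable section
namespace FastGrowing

open FirstOrder FirstOrder.Language

/-! Countably many degrees have a common upper bound, so countably many cones, and hence countably
many values of `g`, have a common element. A notion can therefore be made monotone along any
relation `r` on sequences in which each `S` has only countably many predecessors: intersect the
constraints over all sequences below `S` in the reflexive transitive closure of `r`, which again are
countably many. It remains to express both properties through such an `r`.

For (2), put `T` below `S` when `T` lies in the level of index `δ` over `S`. This level is countable
because `δ < ω₁`: the transitive closure of `{S}` is countable, a Löwenheim–Skolem argument yields
countable limit levels elementary in level `ω₁`, and these satisfy replacement because level `ω₁`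
does (`modelsZFMinusP_of_isElementarySubset`).

For (1), all admissible sequences with last element `d` should be `r`-equivalent, so there must be
only countably many. To this end sequences are coded by degrees `h S` so that each degree bounds
countably many codes, and `f(S)` is cut down to the cone above `h S`. The last element of an
admissible sequence then bounds the code of everything before it (`countable_setOf_hasCodingLast`).
-/

/-! ### Countability and upper bounds of Turing degrees -/

/-- The partial functions obtained from a countable set of oracles by at most `n` nested
applications of the closure operations of oracle computability. -/
def recursiveInStage (O : Set (ℕ →. ℕ)) : ℕ → Set (ℕ →. ℕ)
  | 0 => {fun _ => 0, (Nat.succ : ℕ →. ℕ), fun n => Part.some n.unpair.1,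
      fun n => Part.some n.unpair.2} ∪ O
  | n + 1 => recursiveInStage O n ∪
      (Set.image2 (fun f h : ℕ →. ℕ => fun n => Nat.pair <$> f n <*> h n)
        (recursiveInStage O n) (recursiveInStage O n) ∪
      Set.image2 (fun f h : ℕ →. ℕ => fun n => h n >>= f)
        (recursiveInStage O n) (recursiveInStage O n) ∪
      Set.image2 (fun f h : ℕ →. ℕ => fun p =>
        let (a, n) := Nat.unpair p
        n.rec (f a) fun y IH => do
          let i ← IH
          h (Nat.pair a (Nat.pair y i))) (recursiveInStage O n) (recursiveInStage O n) ∪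
      (fun f : ℕ →. ℕ => fun a => Nat.rfind fun n => (fun m => m = 0) <$> f (Nat.pair a n)) ''
        recursiveInStage O n)

theorem recursiveInStage_mono (O : Set (ℕ →. ℕ)) : Monotone (recursiveInStage O) :=
  monotone_nat_of_le_succ fun _ => Set.subset_union_left

theorem countable_recursiveInStage {O : Set (ℕ →. ℕ)} (hO : O.Countable) (n : ℕ) :
    (recursiveInStage O n).Countable := by
  induction n with
  | zero => exact (((((Set.countable_singleton _).insert _).insert _).insert _)).union hO
  | succ n ih =>
    exact ih.union ((((ih.image2 ih _).union (ih.image2 ih _)).union (ih.image2 ih _)).union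
      (ih.image _))

theorem exists_mem_recursiveInStage {O : Set (ℕ →. ℕ)} {f : ℕ →. ℕ} (hf : Nat.RecursiveIn O f) :
    ∃ n, f ∈ recursiveInStage O n := by
  have key : ∀ {f h : ℕ →. ℕ}, (∃ n, f ∈ recursiveInStage O n) →
      (∃ n, h ∈ recursiveInStage O n) →
      ∃ n, f ∈ recursiveInStage O n ∧ h ∈ recursiveInStage O n := by
    rintro f h ⟨m, hm⟩ ⟨n, hn⟩
    exact ⟨max m n, recursiveInStage_mono O (le_max_left m n) hm,
      recursiveInStage_mono O (le_max_right m n) hn⟩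
  induction hf with
  | zero => exact ⟨0, Or.inl (Or.inl rfl)⟩
  | succ => exact ⟨0, Or.inl (Or.inr (Or.inl rfl))⟩
  | left => exact ⟨0, Or.inl (Or.inr (Or.inr (Or.inl rfl)))⟩
  | right => exact ⟨0, Or.inl (Or.inr (Or.inr (Or.inr rfl)))⟩
  | oracle g hg => exact ⟨0, Or.inr hg⟩
  | pair _ _ ihf ihh =>
    obtain ⟨n, h1, h2⟩ := key ihf ihh
    exact ⟨n + 1, Or.inr (Or.inl (Or.inl (Or.inl ⟨_, h1, _, h2, rfl⟩)))⟩
  | comp _ _ ihf ihh =>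
    obtain ⟨n, h1, h2⟩ := key ihf ihh
    exact ⟨n + 1, Or.inr (Or.inl (Or.inl (Or.inr ⟨_, h1, _, h2, rfl⟩)))⟩
  | prec _ _ ihf ihh =>
    obtain ⟨n, h1, h2⟩ := key ihf ihh
    exact ⟨n + 1, Or.inr (Or.inl (Or.inr ⟨_, h1, _, h2, rfl⟩))⟩
  | rfind _ ih =>
    obtain ⟨n, h1⟩ := ih
    exact ⟨n + 1, Or.inr (Or.inr ⟨_, h1, rfl⟩)⟩

theorem countable_setOf_recursiveIn {O : Set (ℕ →. ℕ)} (hO : O.Countable) :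
    {f : ℕ →. ℕ | Nat.RecursiveIn O f}.Countable :=
  (Set.countable_iUnion (countable_recursiveInStage hO)).mono fun _ hf =>
    Set.mem_iUnion.2 (exists_mem_recursiveInStage hf)

theorem charFun_apply (A : Set ℕ) (n : ℕ) :
    charFun A n = Part.some (A.indicator (fun _ => 1) n) :=
  rfl

theorem charFun_injective : Function.Injective charFun := by
  intro A B h
  ext n
  have := congrFun h n
  rw [charFun_apply, charFun_apply, Part.some_inj] at this
  by_cases hA : n ∈ A <;> by_cases hB : n ∈ B <;> simp_all

theorem countable_setOf_reducible (B : Set ℕ) : {A | Reducible A B}.Countable := by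
  refine Set.Countable.preimage_of_injOn (f := charFun)
    ((countable_setOf_recursiveIn (Set.countable_singleton (charFun B)))) charFun_injective.injOn
    |>.mono fun A hA => RecursiveIn.iff_nat.1 hA

theorem countable_setOf_of_eq (d : Degree) : {A | Degree.of A = d}.Countable := by
  obtain ⟨B, rfl⟩ := Quotient.exists_rep d
  exact (countable_setOf_reducible B).mono fun A (hA : Degree.of A = Degree.of B) =>
    Degree.of_le_of.1 hA.le

theorem countable_setOf_of_le (d : Degree) : {A | Degree.of A ≤ d}.Countable := by
  obtain ⟨B, rfl⟩ := Quotient.exists_rep d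
  exact countable_setOf_reducible B

/-- The join of a sequence of sets of natural numbers. -/
def joinSet (A : ℕ → Set ℕ) : Set ℕ :=
  {m | m.unpair.2 ∈ A m.unpair.1}

theorem pair_mem_joinSet {A : ℕ → Set ℕ} {k n : ℕ} : Nat.pair k n ∈ joinSet A ↔ n ∈ A k := by
  simp [joinSet]

theorem joinSet_injective : Function.Injective joinSet := by
  intro A B h
  funext k
  ext n
  rw [← pair_mem_joinSet, h, pair_mem_joinSet]

theorem reducible_joinSet (A : ℕ → Set ℕ) (k : ℕ) : Reducible (A k) (joinSet A) := by
  have hp : Nat.RecursiveIn {charFun (joinSet A)} ((fun n => Nat.pair k n : ℕ → ℕ) : ℕ →. ℕ) :=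
    Nat.Primrec.recursiveIn (Primrec.nat_iff.1
      (Primrec₂.natPair.comp (Primrec.const k) Primrec.id))
  refine RecursiveIn.iff_nat.2 ((Nat.RecursiveIn.comp
    (Nat.RecursiveIn.oracle _ (Set.mem_singleton _)) hp).of_eq fun n => ?_)
  refine (Part.bind_some (Nat.pair k n) (charFun (joinSet A))).trans ?_
  rw [charFun_apply, charFun_apply]
  congr 1
  by_cases hn : n ∈ A k
  · rw [Set.indicator_of_mem hn, Set.indicator_of_mem (pair_mem_joinSet.2 hn)]
  · rw [Set.indicator_of_notMem hn, Set.indicator_of_notMem (mt pair_mem_joinSet.1 hn)]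

/-- Countable families of Turing degrees are bounded. -/
theorem Degree.exists_upper_bound {ι : Type*} [Countable ι] (d : ι → Degree) :
    ∃ e, ∀ i, d i ≤ e := by
  obtain ⟨s, hs⟩ := exists_injective_nat ι
  choose A hA using fun i => Quotient.exists_rep (d i)
  refine ⟨Degree.of (joinSet (Function.extend s A fun _ => ∅)), fun i => ?_⟩
  rw [← hA i]
  refine Degree.of_le_of.2 ?_
  simpa only [hs.extend_apply] using reducible_joinSet (Function.extend s A fun _ => ∅) (s i)

theorem countable_Iio_of_lt_omega_one {α : Ordinal.{0}} (h : α < ω₁) :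
    Countable (Set.Iio α) := by
  rw [← Cardinal.mk_le_aleph0_iff, Cardinal.mk_Iio_ordinal, Cardinal.lift_le_aleph0]
  rwa [← Cardinal.ord_aleph, Cardinal.lt_ord, ← Cardinal.succ_aleph0, Order.lt_succ_iff] at h

/-- Countable sequences of Turing degrees can be coded by sets of natural numbers. -/
theorem exists_injective_degSeq_code : ∃ c : DegSeq → Set ℕ, Function.Injective c := by
  -- Lengths are coded by reals through `ℵ₁ ≤ 2^ℵ₀`.
  obtain ⟨a⟩ : Nonempty (Set.Iio (ω₁ : Ordinal.{0}) ↪ Set ℕ) := by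
    rw [← Cardinal.lift_mk_le', Cardinal.mk_Iio_ordinal]
    simpa using Cardinal.aleph_one_le_continuum
  have he : ∀ α : Ordinal.{0}, α < ω₁ → ∃ e : Set.Iio α → ℕ, Function.Injective e :=
    fun α h =>
    have := countable_Iio_of_lt_omega_one h
    exists_injective_nat _
  choose e e_inj using he
  -- Column `0` codes the length. Column `k + 1` holds a representative of the term whose index is
  -- numbered `k`, and is empty if there is none.
  refine ⟨fun S => joinSet fun n => Nat.casesOn n (a ⟨S.length, S.length_lt⟩)
    (Function.extend (e S.length S.length_lt) (fun i => Quotient.out (S.term i))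
      fun _ => ∅), ?_⟩
  rintro ⟨α, hα, s⟩ ⟨β, hβ, t⟩ h
  have h := joinSet_injective h
  obtain rfl : α = β := congrArg Subtype.val (a.injective (congrFun h 0))
  have : s = t := by
    funext i
    have := congrFun h (e α hα i + 1)
    simp only [(e_inj α hα).extend_apply] at this
    exact Quotient.out_inj.1 this
  rw [this]

/-- Every countable sequence can be assigned a Turing degree in such a way that each degree
bounds the degrees assigned to only countably many sequences. -/
theorem exists_codeDegree : ∃ h : DegSeq → Degree, ∀ d, {S | h S ≤ d}.Countable := by
  obtain ⟨c, hc⟩ := exists_injective_degSeq_code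
  exact ⟨fun S => Degree.of (c S), fun d =>
    (countable_setOf_of_le d).preimage_of_injOn (f := c) hc.injOn⟩

/-! ### Formulas of the language of set theory -/

/-- The membership symbol. -/
def memSymbol : memLang.Relations 2 :=
  MemRel.mem

/-- The formula `a ∈ b`. -/
def memFormula {α : Type*} (a b : α) : memLang.Formula α :=
  memSymbol.formula₂ (Term.var a) (Term.var b)

/-- The formula `a = b`. -/
def eqFormula {α : Type*} (a b : α) : memLang.Formula α :=
  Term.equal (Term.var a) (Term.var b)

@[simp]
theorem realize_memFormula {M : ZFSet.{0}} {α : Type*} (a b : α) (v : α → M) :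
    (memFormula a b).Realize v ↔ (v a).1 ∈ (v b).1 := by
  rw [memFormula, Formula.realize_rel₂]
  exact Iff.rfl

@[simp]
theorem realize_eqFormula {M : ZFSet.{0}} {α : Type*} (a b : α) (v : α → M) :
    (eqFormula a b).Realize v ↔ v a = v b := by
  simp [eqFormula, Formula.realize_equal]

instance : Countable memLang.Symbols := by
  have : Countable (Σ l, memLang.Relations l) := by
    refine Function.Injective.countable (f := fun r : Σ l, memLang.Relations l => r.1) ?_
    rintro ⟨_, ⟨⟩⟩ ⟨_, ⟨⟩⟩ _
    rfl
  have : IsEmpty (Σ l, memLang.Functions l) := ⟨fun F => Empty.elim F.2⟩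
  exact inferInstanceAs (Countable ((Σ l, memLang.Functions l) ⊕ (Σ l, memLang.Relations l)))

/-- Parameters are indexed by an arbitrary type, so that concrete formulas can name just the few
they use; relabelling turns them into elements of `M`. -/
theorem mem_definablePowerset {M x : ZFSet.{0}} {β : Type*} (φ : memLang.Formula (β ⊕ Fin 1))
    (p : β → M)
    (hx : ∀ y, y ∈ x ↔ ∃ h : y ∈ M, φ.Realize (Sum.elim p fun _ => (⟨y, h⟩ : M))) :
    x ∈ definablePowerset M := by
  rw [definablePowerset, ZFSet.mem_sep, ZFSet.mem_powerset]
  refine ⟨fun y hy => ((hx y).1 hy).1, ?_⟩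
  refine Set.definable_iff_exists_formula_sum.2
    ⟨φ.relabel (Sum.map (fun b => ⟨p b, Set.mem_univ _⟩) id), ?_⟩
  ext v
  simp only [Set.mem_ofPred_eq, Formula.realize_relabel]
  have : (Sum.elim (fun a : (Set.univ : Set M) => (a : M)) v ∘
      Sum.map (fun b => (⟨p b, Set.mem_univ _⟩ : (Set.univ : Set M))) id : β ⊕ Fin 1 → M) =
      Sum.elim p fun _ => (⟨(v 0).1, (v 0).2⟩ : M) := by
    funext i
    rcases i with i | i
    · rfl
    · simp [Subsingleton.elim i 0]
  rw [this, hx]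
  exact ⟨fun ⟨_, h⟩ => h, fun h => ⟨_, h⟩⟩

theorem subset_of_mem_definablePowerset {M x : ZFSet.{0}} (h : x ∈ definablePowerset M) :
    x ⊆ M :=
  ZFSet.mem_powerset.1 (ZFSet.mem_sep.1 h).1

theorem subset_definablePowerset {M : ZFSet.{0}} (hM : M.IsTransitive) :
    M ⊆ definablePowerset M := by
  intro x hx
  refine mem_definablePowerset (β := Unit) (memFormula (Sum.inr 0) (Sum.inl ()))
    (fun _ => ⟨x, hx⟩) fun y => ?_
  simp only [realize_memFormula, Sum.elim_inl, Sum.elim_inr]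
  exact ⟨fun h => ⟨hM x hx h, h⟩, fun h => h.2⟩

theorem self_mem_definablePowerset (M : ZFSet.{0}) : M ∈ definablePowerset M :=
  mem_definablePowerset (β := Empty) ⊤ (fun e => e.elim) fun y => by
    simp

theorem isTransitive_definablePowerset {M : ZFSet.{0}} (hM : M.IsTransitive) :
    (definablePowerset M).IsTransitive := fun _ hx =>
  (subset_of_mem_definablePowerset hx).trans (subset_definablePowerset hM)

/-- A countable language with countably many parameters has countably many formulas, and a defining
formula determines the subset. -/
theorem countable_definablePowerset {M : ZFSet.{0}} [Countable M] :
    Countable (definablePowerset M) := by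
  have key : ∀ x : definablePowerset M, ∃ φ : memLang.Formula ((Set.univ : Set M) ⊕ Fin 1),
      {v : Fin 1 → M | (v 0).1 ∈ x.1} =
        {v | φ.Realize (Sum.elim (fun a : (Set.univ : Set M) => (a : M)) v)} := fun x =>
    Set.definable_iff_exists_formula_sum.1 (ZFSet.mem_sep.1 x.2).2
  choose F hF using key
  refine Function.Injective.countable (f := F) fun x y hxy => Subtype.ext (ZFSet.ext fun z => ?_)
  have h := hF x
  rw [hxy, ← hF y] at h
  have hs : ∀ w : M, w.1 ∈ x.1 ↔ w.1 ∈ y.1 := fun w => Set.ext_iff.1 h fun _ => w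
  exact ⟨fun hz => (hs ⟨z, subset_of_mem_definablePowerset x.2 hz⟩).1 hz,
    fun hz => (hs ⟨z, subset_of_mem_definablePowerset y.2 hz⟩).2 hz⟩

/-! ### The constructible hierarchy over a set -/

theorem isTransitive_trclSingleton (x : ZFSet.{0}) : (trclSingleton x).IsTransitive :=
  fun _ hy _ hz => mem_trclSingleton.2 ((mem_trclSingleton.1 hy).head hz)

theorem mem_LOver_limit {x y : ZFSet.{0}} {l : Ordinal.{0}} (hl : Order.IsSuccLimit l) :
    y ∈ LOver x l ↔ ∃ β < l, y ∈ LOver x β := by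
  rw [LOver_limit x hl, ZFSet.mem_iUnion]
  simp

theorem isTransitive_LOver (x : ZFSet.{0}) (α : Ordinal.{0}) : (LOver x α).IsTransitive := by
  induction α using Ordinal.limitRecOn with
  | zero => rw [LOver_zero]; exact isTransitive_trclSingleton x
  | add_one α ih => rw [LOver_add_one]; exact isTransitive_definablePowerset ih
  | limit l hl ih =>
    intro y hy z hz
    obtain ⟨β, hβ, hy⟩ := (mem_LOver_limit hl).1 hy
    exact (mem_LOver_limit hl).2 ⟨β, hβ, ih β hβ y hy hz⟩

theorem LOver_mono (x : ZFSet.{0}) {α β : Ordinal.{0}} (h : α ≤ β) :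
    LOver x α ⊆ LOver x β := by
  induction β using Ordinal.limitRecOn with
  | zero => rw [nonpos_iff_eq_zero.1 h]
  | add_one β ih =>
    rcases h.eq_or_lt with rfl | h
    · exact subset_rfl
    · rw [LOver_add_one]
      exact (ih (Order.lt_add_one_iff.1 h)).trans
        (subset_definablePowerset (isTransitive_LOver x β))
  | limit l hl ih =>
    rcases h.eq_or_lt with rfl | h
    · exact subset_rfl
    · exact fun y hy => (mem_LOver_limit hl).2 ⟨α, h, hy⟩

theorem countable_LOver {x : ZFSet.{0}} (hx : Countable (trclSingleton x)) {α : Ordinal.{0}}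
    (hα : α < ω₁) : Countable (LOver x α) := by
  induction α using Ordinal.limitRecOn with
  | zero => rwa [LOver_zero]
  | add_one α ih =>
    rw [LOver_add_one]
    have := ih ((Order.lt_add_one_iff.2 le_rfl).trans hα)
    exact countable_definablePowerset
  | limit l hl ih =>
    have := countable_Iio_of_lt_omega_one hα
    have h : ∀ β : Set.Iio l, ((LOver x β.1 : ZFSet.{0}) : Set ZFSet.{0}).Countable := fun β =>
      Set.countable_coe_iff.1 (ih β.1 β.2 (β.2.trans hα))
    refine Set.countable_coe_iff.2 ((Set.countable_iUnion h).mono ?_)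
    intro y hy
    obtain ⟨β, hβ, hy⟩ := (mem_LOver_limit hl).1 hy
    exact Set.mem_iUnion.2 ⟨⟨β, hβ⟩, hy⟩

/-! ### Countability of the transitive closure of a sequence of degrees -/

/-- The sets reached from `x` by `n` steps down along membership. -/
def iteratedMembers (x : ZFSet.{0}) : ℕ → Set ZFSet.{0}
  | 0 => {x}
  | n + 1 => ⋃ y ∈ iteratedMembers x n, (y : Set ZFSet.{0})

theorem iteratedMembers_subset (x : ZFSet.{0}) (n : ℕ) :
    iteratedMembers x n ⊆ (trclSingleton x : Set ZFSet.{0}) := by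
  induction n with
  | zero =>
    rintro _ rfl
    exact mem_trclSingleton.2 .refl
  | succ n ih =>
    exact Set.iUnion₂_subset fun y hy z hz => isTransitive_trclSingleton x y (ih hy) hz

theorem exists_mem_iteratedMembers {x y : ZFSet.{0}}
    (h : Relation.ReflTransGen (fun a b : ZFSet.{0} => a ∈ b) y x) :
    ∃ n, y ∈ iteratedMembers x n := by
  induction h using Relation.ReflTransGen.head_induction_on with
  | refl => exact ⟨0, rfl⟩
  | head hab _ ih =>
    obtain ⟨n, hn⟩ := ih
    exact ⟨n + 1, Set.mem_biUnion hn hab⟩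

theorem countable_trclSingleton {x : ZFSet.{0}}
    (h : ∀ y ∈ trclSingleton x, (y : Set ZFSet.{0}).Countable) : Countable (trclSingleton x) := by
  have hs : ∀ n, (iteratedMembers x n).Countable := by
    intro n
    induction n with
    | zero => exact Set.countable_singleton x
    | succ n ih => exact ih.biUnion fun y hy => h y (iteratedMembers_subset x n hy)
  exact Set.countable_coe_iff.2 ((Set.countable_iUnion hs).mono fun y hy =>
    Set.mem_iUnion.2 (exists_mem_iteratedMembers (mem_trclSingleton.1 hy)))

/-- A set all of whose hereditary members are countable. -/
def HereditarilyCountable (x : ZFSet.{0}) : Prop :=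
  ∀ y ∈ trclSingleton x, (y : Set ZFSet.{0}).Countable

theorem HereditarilyCountable.of_mem {x : ZFSet.{0}} (hx : (x : Set ZFSet.{0}).Countable)
    (h : ∀ y ∈ x, HereditarilyCountable y) : HereditarilyCountable x := by
  intro y hy
  rcases Relation.ReflTransGen.cases_tail (mem_trclSingleton.1 hy) with rfl | ⟨z, hyz, hz⟩
  · exact hx
  · exact h z hz y (mem_trclSingleton.2 hyz)

theorem HereditarilyCountable.range {ι : Type*} [Small.{0} ι] [Countable ι] {f : ι → ZFSet.{0}}
    (h : ∀ i, HereditarilyCountable (f i)) : HereditarilyCountable (ZFSet.range f) := by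
  refine .of_mem ?_ fun y hy => ?_
  · rw [ZFSet.coe_range]
    exact Set.countable_range f
  · obtain ⟨i, rfl⟩ := ZFSet.mem_range.1 hy
    exact h i

theorem HereditarilyCountable.unorderedPair {x y : ZFSet.{0}} (hx : HereditarilyCountable x)
    (hy : HereditarilyCountable y) : HereditarilyCountable {x, y} := by
  refine .of_mem ?_ fun z hz => ?_
  · refine ((Set.countable_singleton y).insert x).mono fun z hz => ?_
    simpa using hz
  · rcases ZFSet.mem_pair.1 hz with rfl | rfl
    exacts [hx, hy]

theorem HereditarilyCountable.pair {x y : ZFSet.{0}} (hx : HereditarilyCountable x)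
    (hy : HereditarilyCountable y) : HereditarilyCountable (ZFSet.pair x y) := by
  refine .unorderedPair ?_ (hx.unorderedPair hy)
  refine .of_mem ?_ fun z hz => ?_
  · refine (Set.countable_singleton x).mono fun z hz => ?_
    simpa using hz
  · rw [ZFSet.mem_singleton.1 hz]
    exact hx

theorem hereditarilyCountable_toZFSet {α : Ordinal.{0}} (h : α < ω₁) :
    HereditarilyCountable α.toZFSet := by
  induction α using WellFoundedLT.induction with
  | ind α ih =>
    have := countable_Iio_of_lt_omega_one h
    refine .of_mem ?_ fun y hy => ?_
    · rw [Ordinal.coe_toZFSet]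
      exact (Set.countable_coe_iff.1 this).image _
    · obtain ⟨β, hβ, rfl⟩ := Ordinal.mem_toZFSet_iff.1 hy
      exact ih β hβ (hβ.trans h)

theorem hereditarilyCountable_realSet (A : Set ℕ) : HereditarilyCountable (realSet A) :=
  .range fun _ => hereditarilyCountable_toZFSet
    ((Ordinal.natCast_lt_omega0 _).trans Ordinal.omega0_lt_omega_one)

theorem hereditarilyCountable_degreeSet (d : Degree) : HereditarilyCountable (degreeSet d) :=
  have : Countable {A : Set ℕ // Degree.of A = d} :=
    Set.countable_coe_iff.2 (countable_setOf_of_eq d)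
  .range fun A => hereditarilyCountable_realSet A.1

/-- A degree contains only countably many reals, and the indices are countable ordinals, so
everything below `S` is hereditarily countable. -/
theorem countable_trclSingleton_toSet (S : DegSeq) : Countable (trclSingleton S.toSet) :=
  have := countable_Iio_of_lt_omega_one S.length_lt
  countable_trclSingleton <| HereditarilyCountable.range fun i =>
    (hereditarilyCountable_toZFSet (i.2.trans S.length_lt)).pair
      (hereditarilyCountable_degreeSet (S.term i))

/-! ### Closure of limit levels of the constructible hierarchy -/

section Limit

variable {x : ZFSet.{0}} {l : Ordinal.{0}}

theorem mem_LOver_limit_of_mem_definablePowerset (hl : Order.IsSuccLimit l) {α : Ordinal.{0}}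
    (hα : α < l) {y : ZFSet.{0}} (hy : y ∈ definablePowerset (LOver x α)) : y ∈ LOver x l :=
  (mem_LOver_limit hl).2 ⟨α + 1, hl.add_one_lt hα, by rwa [LOver_add_one]⟩

theorem exists_common_level (hl : Order.IsSuccLimit l) {y z : ZFSet.{0}} (hy : y ∈ LOver x l)
    (hz : z ∈ LOver x l) : ∃ α < l, y ∈ LOver x α ∧ z ∈ LOver x α := by
  obtain ⟨α, hα, hy⟩ := (mem_LOver_limit hl).1 hy
  obtain ⟨β, hβ, hz⟩ := (mem_LOver_limit hl).1 hz
  exact ⟨max α β, max_lt hα hβ, LOver_mono x (le_max_left _ _) hy,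
    LOver_mono x (le_max_right _ _) hz⟩

theorem pair_mem_LOver_limit (hl : Order.IsSuccLimit l) {y z : ZFSet.{0}} (hy : y ∈ LOver x l)
    (hz : z ∈ LOver x l) : ({y, z} : ZFSet.{0}) ∈ LOver x l := by
  obtain ⟨α, hα, hy, hz⟩ := exists_common_level hl hy hz
  refine mem_LOver_limit_of_mem_definablePowerset hl hα (mem_definablePowerset (β := Bool)
    (eqFormula (Sum.inr 0) (Sum.inl true) ⊔ eqFormula (Sum.inr 0) (Sum.inl false))
    (fun b => cond b ⟨y, hy⟩ ⟨z, hz⟩) fun w => ?_)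
  simp only [ZFSet.mem_pair, Formula.realize_sup, realize_eqFormula, Sum.elim_inr, Sum.elim_inl,
    cond_true, cond_false, Subtype.mk.injEq]
  constructor
  · rintro (rfl | rfl)
    exacts [⟨hy, .inl rfl⟩, ⟨hz, .inr rfl⟩]
  · exact fun h => h.2

theorem sUnion_mem_LOver_limit (hl : Order.IsSuccLimit l) {y : ZFSet.{0}} (hy : y ∈ LOver x l) :
    ZFSet.sUnion y ∈ LOver x l := by
  obtain ⟨α, hα, hy⟩ := (mem_LOver_limit hl).1 hy
  have ht := isTransitive_LOver x α
  refine mem_LOver_limit_of_mem_definablePowerset hl hα (mem_definablePowerset (β := Unit)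
    (Formula.iExs (Fin 1) (memFormula (Sum.inr 0) (Sum.inl (Sum.inl ())) ⊓
      memFormula (Sum.inl (Sum.inr 0)) (Sum.inr 0)))
    (fun _ => ⟨y, hy⟩) fun w => ?_)
  simp only [ZFSet.mem_sUnion, Formula.realize_iExs, Formula.realize_inf, realize_memFormula,
    Sum.elim_inr, Sum.elim_inl]
  constructor
  · rintro ⟨z, hz, hw⟩
    exact ⟨ht z (ht y hy hz) hw, fun _ => ⟨z, ht y hy hz⟩, hz, hw⟩
  · rintro ⟨_, i, hz, hw⟩
    exact ⟨_, hz, hw⟩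

theorem insert_self_mem_LOver_limit (hl : Order.IsSuccLimit l) {y : ZFSet.{0}}
    (hy : y ∈ LOver x l) : insert y y ∈ LOver x l := by
  -- `y ∪ {y}` is the union of `{y, {y, y}}`.
  have h := sUnion_mem_LOver_limit hl
    (pair_mem_LOver_limit hl hy (pair_mem_LOver_limit hl hy hy))
  convert h using 1
  ext z
  simp [or_comm]

theorem LOver_mem_LOver_limit (hl : Order.IsSuccLimit l) {α : Ordinal.{0}} (hα : α < l) :
    LOver x α ∈ LOver x l :=
  mem_LOver_limit_of_mem_definablePowerset hl hα (self_mem_definablePowerset _)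

theorem empty_mem_LOver_limit (hl : Order.IsSuccLimit l) : (∅ : ZFSet.{0}) ∈ LOver x l :=
  mem_LOver_limit_of_mem_definablePowerset hl hl.bot_lt
    (mem_definablePowerset (β := Empty) ⊥ (fun e => e.elim) fun y => by simp)

end Limit

/-- Above `ω`, limit levels of the hierarchy satisfy the axioms of `ZF` without power set as soon
as they satisfy replacement: separation is an instance of replacement for partial functions. -/
theorem modelsZFMinusP_of_replacement {x : ZFSet.{0}} {l : Ordinal.{0}}
    (hl : Order.IsSuccLimit l) (hω : ω < l)
    (h : ∀ F : Set (LOver x l × LOver x l), (Set.univ : Set (LOver x l)).Definable₂ memLang F →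
      ∀ a : LOver x l, (∀ u : LOver x l, u.1 ∈ a.1 →
          ∀ y z : LOver x l, (u, y) ∈ F → (u, z) ∈ F → y = z) →
        ∃ b : LOver x l, ∀ y : LOver x l, y.1 ∈ b.1 ↔ ∃ u : LOver x l, u.1 ∈ a.1 ∧ (u, y) ∈ F) :
    ModelsZFMinusP (LOver x l) where
  extensionality y z hyz := by
    have ht := isTransitive_LOver x l
    refine Subtype.ext (ZFSet.ext fun w => ⟨fun hw => ?_, fun hw => ?_⟩)
    · exact (hyz ⟨w, ht _ y.2 hw⟩).1 hw
    · exact (hyz ⟨w, ht _ z.2 hw⟩).2 hw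
  foundation y hy := by
    obtain ⟨z, hz, hmin⟩ := WellFounded.has_min (ZFSet.mem_wf.{0}) (y.1 : Set ZFSet.{0})
      (hy.imp' Subtype.val fun _ hz => hz)
    exact ⟨⟨z, isTransitive_LOver x l _ y.2 hz⟩, hz, fun w hw => hmin w.1 hw⟩
  pairing y z := ⟨⟨{y.1, z.1}, pair_mem_LOver_limit hl y.2 z.2⟩, fun w => by
    rw [ZFSet.mem_pair, Subtype.ext_iff, Subtype.ext_iff]⟩
  union y := by
    refine ⟨⟨ZFSet.sUnion y.1, sUnion_mem_LOver_limit hl y.2⟩, fun w => ?_⟩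
    rw [ZFSet.mem_sUnion]
    exact ⟨fun ⟨z, hz, hw⟩ => ⟨⟨z, isTransitive_LOver x l _ y.2 hz⟩, hz, hw⟩,
      fun ⟨z, hz, hw⟩ => ⟨z.1, hz, hw⟩⟩
  infinity := by
    -- The level `ω` is itself an inductive set, being a limit level.
    refine ⟨⟨LOver x ω, LOver_mem_LOver_limit hl hω⟩,
      ⟨⟨∅, empty_mem_LOver_limit hl⟩, empty_mem_LOver_limit Ordinal.isSuccLimit_omega0,
        fun z => ZFSet.notMem_empty z.1⟩, fun y hy => ?_⟩
    refine ⟨⟨insert y.1 y.1, insert_self_mem_LOver_limit hl y.2⟩,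
      insert_self_mem_LOver_limit Ordinal.isSuccLimit_omega0 hy, fun z => ?_⟩
    rw [ZFSet.mem_insert_iff, or_comm, Subtype.ext_iff]
  separation D hD a := by
    -- Separation by `D` is replacement along the identity restricted to `D`.
    have hF : (Set.univ : Set (LOver x l)).Definable₂ memLang
        {p : LOver x l × LOver x l | p.1 = p.2 ∧ p.1 ∈ D} := by
      obtain ⟨φ, hφ⟩ := Set.definable_iff_exists_formula_sum.1 hD
      refine Set.definable_iff_exists_formula_sum.2
        ⟨eqFormula (Sum.inr 0) (Sum.inr 1) ⊓ φ.relabel (Sum.map id fun _ => 0), ?_⟩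
      ext v
      have hv := Set.ext_iff.1 hφ fun _ => v 0
      simp only [Set.mem_ofPred_eq] at hv
      simp only [Set.mem_ofPred_eq, Formula.realize_inf, realize_eqFormula, Sum.elim_inr,
        Formula.realize_relabel, hv, Sum.elim_comp_map, Function.comp_id]
      rfl
    obtain ⟨b, hb⟩ := h _ hF a fun u _ y z hy hz => hy.1.symm.trans hz.1
    refine ⟨b, fun y => (hb y).trans ⟨?_, ?_⟩⟩
    · rintro ⟨u, hu, huy, hD⟩
      obtain rfl : u = y := huy
      exact ⟨hu, hD⟩
    · exact fun hy => ⟨y, hy.1, rfl, hy.2⟩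
  replacement := h

/-! ### Elementary levels of the hierarchy -/

/-- The inclusion of structures for the language of set theory. -/
def inclusionEmbedding {A B : ZFSet.{0}} (h : A ⊆ B) : A ↪[memLang] B where
  toFun a := ⟨a.1, h a.2⟩
  inj' a b hab := Subtype.ext (congrArg (fun c : B => c.1) hab)
  map_fun' F := Empty.elim F
  map_rel' R v := by
    cases R
    exact Iff.rfl

/-- `A` is an elementary substructure of `B`. -/
def IsElementarySubset (A B : ZFSet.{0}) : Prop :=
  ∃ f : A ↪ₑ[memLang] B, ∀ a, (f a).1 = a.1

/-- This is the Tarski–Vaught test. -/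
theorem isElementarySubset_of_exists {A B : ZFSet.{0}} (h : A ⊆ B)
    (H : ∀ (n : ℕ) (φ : memLang.BoundedFormula Empty (n + 1)) (v : Fin n → A) (b : B),
      φ.Realize default (Fin.snoc (inclusionEmbedding h ∘ v) b : Fin (n + 1) → B) →
        ∃ b : B, b.1 ∈ A ∧
          φ.Realize default (Fin.snoc (inclusionEmbedding h ∘ v) b : Fin (n + 1) → B)) :
    IsElementarySubset A B := by
  refine ⟨(inclusionEmbedding h).toElementaryEmbedding fun n φ v b hb => ?_, fun _ => rfl⟩
  obtain ⟨c, hc, hφ⟩ := H n φ v b hb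
  exact ⟨⟨c.1, hc⟩, hφ⟩

theorem isSuccLimit_omega_one : Order.IsSuccLimit (ω₁ : Ordinal.{0}) :=
  Cardinal.isSuccLimit_omega 1

/-- One step of a Skolem closure: there are countably many formulas and countably many tuples from
level `α`, so the levels of chosen witnesses have a supremum below `ω₁`. -/
theorem exists_witness_level {x : ZFSet.{0}} (hx : Countable (trclSingleton x))
    {α : Ordinal.{0}} (hα : α < ω₁) :
    ∃ β, α < β ∧ β < ω₁ ∧ ∀ (n : ℕ) (φ : memLang.BoundedFormula Empty (n + 1))
      (v : Fin n → LOver x ω₁) (b : LOver x ω₁), (∀ i, (v i).1 ∈ LOver x α) →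
        φ.Realize default (Fin.snoc v b : Fin (n + 1) → LOver x ω₁) →
          ∃ b : LOver x ω₁, b.1 ∈ LOver x β ∧
            φ.Realize default (Fin.snoc v b : Fin (n + 1) → LOver x ω₁) := by
  have := countable_LOver hx hα
  have hc : ∀ n, Countable (memLang.BoundedFormula Empty (n + 1)) := fun n =>
    Function.Injective.countable
      (f := fun φ => (⟨n + 1, φ⟩ : Σ n, memLang.BoundedFormula Empty n)) sigma_mk_injective
  let I := Σ n : ℕ, memLang.BoundedFormula Empty (n + 1) × (Fin n → LOver x α)
  let e : LOver x α → LOver x ω₁ := inclusionEmbedding (LOver_mono x hα.le)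
  have key : ∀ i : I, ∃ γ < ω₁, ∀ b : LOver x ω₁,
      i.2.1.Realize default (Fin.snoc (e ∘ i.2.2) b : Fin (i.1 + 1) → LOver x ω₁) →
      ∃ b : LOver x ω₁, b.1 ∈ LOver x γ ∧
        i.2.1.Realize default (Fin.snoc (e ∘ i.2.2) b : Fin (i.1 + 1) → LOver x ω₁) := by
    intro i
    by_cases h : ∃ b : LOver x ω₁,
      i.2.1.Realize default (Fin.snoc (e ∘ i.2.2) b : Fin (i.1 + 1) → LOver x ω₁)
    · obtain ⟨b, hb⟩ := h
      obtain ⟨γ, hγ, hbγ⟩ := (mem_LOver_limit isSuccLimit_omega_one).1 b.2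
      exact ⟨γ, hγ, fun _ _ => ⟨b, hbγ, hb⟩⟩
    · exact ⟨α, hα, fun b hb => (h ⟨b, hb⟩).elim⟩
  choose γ hγ hw using key
  refine ⟨max (α + 1) (⨆ i, γ i), lt_max_of_lt_left (Order.lt_add_one_iff.2 le_rfl),
    max_lt (isSuccLimit_omega_one.add_one_lt hα) (Ordinal.iSup_lt_omega_one hγ), ?_⟩
  intro n φ v b hv hb
  obtain ⟨c, hc, hφ⟩ := hw ⟨n, φ, fun i => ⟨(v i).1, hv i⟩⟩ b hb
  exact ⟨c, LOver_mono x ((Ordinal.le_iSup γ _).trans (le_max_right _ _)) hc, hφ⟩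

/-- The countable limit levels that are elementary in the level `ω₁` are unbounded. -/
theorem exists_isElementarySubset {x : ZFSet.{0}} (hx : Countable (trclSingleton x))
    {α : Ordinal.{0}} (hα : α < ω₁) :
    ∃ β, α < β ∧ β < ω₁ ∧ Order.IsSuccLimit β ∧
      IsElementarySubset (LOver x β) (LOver x ω₁) := by
  choose s hs hs1 hsw using fun (β : Set.Iio (ω₁ : Ordinal.{0})) => exists_witness_level hx β.2
  -- Iterating the witness step `ω` times closes off: a tuple from the union is finite, so it lies
  -- in one stage, and its witness lies in the next.
  let G : ℕ → Set.Iio (ω₁ : Ordinal.{0}) := fun n =>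
    Nat.rec ⟨α, hα⟩ (fun _ β => ⟨s β, hs1 β⟩) n
  have hG : ∀ n, (G n).1 < (G (n + 1)).1 := fun n => hs (G n)
  have hGm : Monotone fun n => (G n).1 := monotone_nat_of_le_succ fun n => (hG n).le
  have hle : ∀ n, (G n).1 ≤ ⨆ n, (G n).1 := fun n => Ordinal.le_iSup (fun n => (G n).1) n
  have hlt : ∀ n, (G n).1 < ⨆ n, (G n).1 := fun n => (hG n).trans_le (hle (n + 1))
  have hlim : Order.IsSuccLimit (⨆ n, (G n).1) := by
    rw [Ordinal.isSuccLimit_iff, Order.isSuccPrelimit_iff_succ_lt]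
    refine ⟨(bot_le.trans_lt (hlt 0)).ne', fun β hβ => ?_⟩
    obtain ⟨n, hn⟩ := Ordinal.lt_iSup_iff.1 hβ
    exact (Order.succ_le_of_lt hn).trans_lt (hlt n)
  have hω : ⨆ n, (G n).1 < ω₁ := Ordinal.iSup_lt_omega_one fun n => (G n).2
  refine ⟨_, hlt 0, hω, hlim, isElementarySubset_of_exists (LOver_mono x hω.le) ?_⟩
  intro n φ v b hb
  have hlev : ∀ i, ∃ k, (v i).1 ∈ LOver x (G k).1 := by
    intro i
    obtain ⟨β, hβ, hvβ⟩ := (mem_LOver_limit hlim).1 (v i).2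
    obtain ⟨k, hk⟩ := Ordinal.lt_iSup_iff.1 hβ
    exact ⟨k, LOver_mono x hk.le hvβ⟩
  choose k hk using hlev
  obtain ⟨c, hc, hφ⟩ := hsw (G (Finset.univ.sup k)) n φ _ b
    (fun i => LOver_mono x (hGm (Finset.le_sup (Finset.mem_univ i))) (hk i)) hb
  exact ⟨c, LOver_mono x (hle (Finset.univ.sup k + 1)) hc, hφ⟩

/-! ### Replacement in level `ω₁` and in its elementary sublevels -/

theorem realize_relabel_pair {M : ZFSet.{0}} {V W : Type*} (φ : memLang.Formula (V ⊕ Fin 2))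
    (w : W → M) (f : V → W) (i j : W) :
    (φ.relabel (Sum.elim f ![i, j])).Realize w ↔
      φ.Realize (Sum.elim (fun p => w (f p)) ![w i, w j]) := by
  rw [Formula.realize_relabel]
  refine iff_of_eq (congrArg _ (funext fun k => ?_))
  rcases k with k | k
  · rfl
  · fin_cases k <;> rfl

theorem forall_fin_one {M : Type*} {P : (Fin 1 → M) → Prop} :
    (∀ i, P i) ↔ ∀ y, P fun _ => y :=
  ⟨fun h y => h _, fun h i => by
    convert h (i 0) using 1
    exact funext fun j => by rw [Subsingleton.elim j 0]⟩

theorem exists_fin_one {M : Type*} {P : (Fin 1 → M) → Prop} :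
    (∃ i, P i) ↔ ∃ y, P fun _ => y := by
  simpa using (forall_fin_one (P := fun i => ¬ P i)).not

/-- The formula saying that `y` is in the image of `a` under the relation defined by `φ`. -/
def imageMemFormula {V : Type*} (φ : memLang.Formula (V ⊕ Fin 2)) (a : V) :
    memLang.Formula (V ⊕ Fin 1) :=
  Formula.iExs (Fin 1) (memFormula (Sum.inr 0) (Sum.inl (Sum.inl a)) ⊓
    φ.relabel (Sum.elim (fun p => Sum.inl (Sum.inl p)) ![Sum.inr 0, Sum.inl (Sum.inr 0)]))

theorem realize_imageMemFormula {M : ZFSet.{0}} {V : Type*} (φ : memLang.Formula (V ⊕ Fin 2))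
    (a : V) (v : V → M) (i : Fin 1 → M) :
    (imageMemFormula φ a).Realize (Sum.elim v i) ↔
      ∃ u : M, u.1 ∈ (v a).1 ∧ φ.Realize (Sum.elim v ![u, i 0]) := by
  rw [imageMemFormula, Formula.realize_iExs, exists_fin_one]
  refine exists_congr fun u => ?_
  rw [Formula.realize_inf, realize_memFormula, realize_relabel_pair]
  exact Iff.rfl

/-- The formula saying that `b` is the image of `a` under the relation defined by `φ`. -/
def imageFormula {V : Type*} (φ : memLang.Formula (V ⊕ Fin 2)) (a : V) :
    memLang.Formula (V ⊕ Fin 1) :=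
  Formula.iAlls (Fin 1) ((memFormula (Sum.inr 0) (Sum.inl (Sum.inr 0))).iff
    ((imageMemFormula φ a).relabel (Sum.map Sum.inl id)))

theorem realize_imageFormula {M : ZFSet.{0}} {V : Type*} (φ : memLang.Formula (V ⊕ Fin 2))
    (a : V) (v : V → M) (i : Fin 1 → M) :
    (imageFormula φ a).Realize (Sum.elim v i) ↔
      ∀ y : M, y.1 ∈ (i 0).1 ↔ ∃ u : M, u.1 ∈ (v a).1 ∧ φ.Realize (Sum.elim v ![u, y]) := by
  rw [imageFormula, Formula.realize_iAlls, forall_fin_one]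
  refine forall_congr' fun y => ?_
  rw [Formula.realize_iff, realize_memFormula, Formula.realize_relabel, Sum.elim_comp_map,
    realize_imageMemFormula]
  exact Iff.rfl

/-- The formula saying that the relation defined by `φ` is single-valued on `a`. -/
def singleValuedFormula {V : Type*} (φ : memLang.Formula (V ⊕ Fin 2)) (a : V) :
    memLang.Formula V :=
  Formula.iAlls (Fin 3) ((memFormula (Sum.inr 0) (Sum.inl a)).imp
    ((φ.relabel (Sum.elim Sum.inl ![Sum.inr 0, Sum.inr 1])).imp
      ((φ.relabel (Sum.elim Sum.inl ![Sum.inr 0, Sum.inr 2])).imp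
        (eqFormula (Sum.inr 1) (Sum.inr 2)))))

theorem realize_singleValuedFormula {M : ZFSet.{0}} {V : Type*}
    (φ : memLang.Formula (V ⊕ Fin 2)) (a : V) (v : V → M) :
    (singleValuedFormula φ a).Realize v ↔ ∀ u : M, u.1 ∈ (v a).1 → ∀ y z : M,
      φ.Realize (Sum.elim v ![u, y]) → φ.Realize (Sum.elim v ![u, z]) → y = z := by
  rw [singleValuedFormula, Formula.realize_iAlls]
  simp only [Formula.realize_imp, realize_memFormula, realize_eqFormula, realize_relabel_pair]
  exact ⟨fun h u hu y z hy hz => h ![u, y, z] hu hy hz,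
    fun h i hu hy hz => h (i 0) hu (i 1) (i 2) hy hz⟩

/-- Replacement in the level `ω₁`. -/
theorem exists_image_LOver_omega_one {x : ZFSet.{0}} (hx : Countable (trclSingleton x))
    {β : Ordinal.{0}} (hβ : β < ω₁) {V : Type*} (φ : memLang.Formula (V ⊕ Fin 2)) (a : V)
    (v : V → LOver x ω₁) (hv : ∀ p, (v p).1 ∈ LOver x β)
    (hF : ∀ u : LOver x ω₁, u.1 ∈ (v a).1 → ∀ y z : LOver x ω₁,
      φ.Realize (Sum.elim v ![u, y]) → φ.Realize (Sum.elim v ![u, z]) → y = z) :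
    ∃ b : LOver x ω₁, ∀ y : LOver x ω₁, y.1 ∈ b.1 ↔
      ∃ u : LOver x ω₁, u.1 ∈ (v a).1 ∧ φ.Realize (Sum.elim v ![u, y]) := by
  have hcβ := countable_LOver hx hβ
  have haβ : ∀ u : LOver x ω₁, u.1 ∈ (v a).1 → u.1 ∈ LOver x β := fun u hu =>
    isTransitive_LOver x β _ (hv a) hu
  -- Each `u` in `a` has at most one value, so one countable level per `u` captures it; as level `β`
  -- is countable, a single countable level captures the whole image.
  have key : ∀ u : LOver x β, ∃ γ < ω₁, ∀ w y : LOver x ω₁, w.1 = u.1 → w.1 ∈ (v a).1 →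
      φ.Realize (Sum.elim v ![w, y]) → y.1 ∈ LOver x γ := by
    intro u
    by_cases h : ∃ w y : LOver x ω₁, w.1 = u.1 ∧ w.1 ∈ (v a).1 ∧ φ.Realize (Sum.elim v ![w, y])
    · obtain ⟨w, y, hw, hwa, hy⟩ := h
      obtain ⟨γ, hγ, hyγ⟩ := (mem_LOver_limit isSuccLimit_omega_one).1 y.2
      refine ⟨γ, hγ, fun w' y' hw' hwa' hy' => ?_⟩
      obtain rfl : w' = w := Subtype.ext (hw'.trans hw.symm)
      rwa [hF w' hwa y' y hy' hy]
    · exact ⟨0, Ordinal.omega_pos 1, fun w y hw hwa hy => (h ⟨w, y, hw, hwa, hy⟩).elim⟩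
  choose γ hγ hw using key
  -- The image is defined by a formula evaluated in level `ω₁`. An elementary level `l` containing
  -- the parameters and the image evaluates it identically, so the image is definable over level
  -- `l`.
  obtain ⟨l, hl, hlω, -, g, hg⟩ := exists_isElementarySubset hx
    (max_lt hβ (Ordinal.iSup_lt_omega_one hγ))
  have hβl : LOver x β ⊆ LOver x l := LOver_mono x ((le_max_left _ _).trans hl.le)
  have himg : ∀ u y : LOver x ω₁, u.1 ∈ (v a).1 → φ.Realize (Sum.elim v ![u, y]) →
      y.1 ∈ LOver x l := fun u y hu hy =>
    LOver_mono x ((Ordinal.le_iSup γ _).trans ((le_max_right _ _).trans hl.le))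
      (hw ⟨u.1, haβ u hu⟩ u y rfl hu hy)
  let v' : V → LOver x l := fun p => ⟨(v p).1, hβl (hv p)⟩
  have hreal : ∀ u y : LOver x l, φ.Realize (Sum.elim v' ![u, y]) ↔
      φ.Realize (Sum.elim v ![g u, g y]) := by
    intro u y
    rw [← g.map_formula]
    refine iff_of_eq (congrArg _ (funext fun k => ?_))
    rcases k with k | k
    · exact Subtype.ext (hg _)
    · fin_cases k <;> rfl
  let b : ZFSet.{0} := ZFSet.sep (fun y => ∃ u y' : LOver x ω₁, y'.1 = y ∧ u.1 ∈ (v a).1 ∧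
    φ.Realize (Sum.elim v ![u, y'])) (LOver x l)
  have hb : b ∈ definablePowerset (LOver x l) := by
    refine mem_definablePowerset (imageMemFormula φ a) v' fun y => ?_
    rw [ZFSet.mem_sep]
    simp only [realize_imageMemFormula, hreal]
    constructor
    · rintro ⟨hy, u, y', rfl, hu, hφ⟩
      refine ⟨hy, ⟨u.1, hβl (haβ u hu)⟩, hu, ?_⟩
      convert hφ
      exacts [Subtype.ext (hg _), Subtype.ext (hg _)]
    · rintro ⟨hy, u, hu, hφ⟩
      exact ⟨hy, g u, g ⟨y, hy⟩, hg _, by rwa [hg], hφ⟩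
  refine ⟨⟨b, mem_LOver_limit_of_mem_definablePowerset isSuccLimit_omega_one hlω hb⟩,
    fun y => ?_⟩
  rw [ZFSet.mem_sep]
  constructor
  · rintro ⟨-, u, y', hy', hu, hφ⟩
    obtain rfl : y' = y := Subtype.ext hy'
    exact ⟨u, hu, hφ⟩
  · rintro ⟨u, hu, hφ⟩
    exact ⟨himg u y hu hφ, u, y, rfl, hu, hφ⟩

/-- Single-valuedness is a first-order statement and passes up to level `ω₁`; there the image
exists, and its existence passes back down. -/
theorem modelsZFMinusP_of_isElementarySubset {x : ZFSet.{0}} (hx : Countable (trclSingleton x))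
    {l : Ordinal.{0}} (hl : Order.IsSuccLimit l) (hω : ω < l) (hlω : l < ω₁)
    (h : IsElementarySubset (LOver x l) (LOver x ω₁)) : ModelsZFMinusP (LOver x l) := by
  obtain ⟨f, hf⟩ := h
  refine modelsZFMinusP_of_replacement hl hω fun F hF a hsv => ?_
  obtain ⟨φ, hφ⟩ := Set.definable_iff_exists_formula_sum.1 hF
  let v : ↥(Set.univ : Set (LOver x l)) → LOver x l := Subtype.val
  have hF' : ∀ u y : LOver x l, (u, y) ∈ F ↔ φ.Realize (Sum.elim v ![u, y]) := fun u y =>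
    Set.ext_iff.1 hφ ![u, y]
  let a' : (Set.univ : Set (LOver x l)) := ⟨a, Set.mem_univ a⟩
  have h1 : (singleValuedFormula φ a').Realize v := by
    rw [realize_singleValuedFormula]
    intro u hu y z hy hz
    exact hsv u hu y z ((hF' u y).2 hy) ((hF' u z).2 hz)
  rw [← f.map_formula, realize_singleValuedFormula] at h1
  -- The parameters are all the elements of level `l`, so `l` itself serves as the countable level
  -- containing them.
  obtain ⟨b, hb⟩ := exists_image_LOver_omega_one hx hlω φ a' (f ∘ v)
    (fun p => by rw [Function.comp_apply, hf]; exact (v p).2) h1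
  have h2 : (Formula.iExs (Fin 1) (imageFormula φ a')).Realize (f ∘ v) := by
    rw [Formula.realize_iExs]
    exact ⟨fun _ => b, (realize_imageFormula φ a' (f ∘ v) _).2 hb⟩
  rw [f.map_formula, Formula.realize_iExs] at h2
  obtain ⟨i, hi⟩ := h2
  refine ⟨i 0, fun y => ((realize_imageFormula φ a' v i).1 hi y).trans ?_⟩
  exact exists_congr fun u => and_congr_right' (hF' u y).symm

/-- Over a set with countable transitive closure, some countable level of the constructible
hierarchy is a model of `ZF` without power set. -/
theorem exists_modelsZFMinusP_LOver {x : ZFSet.{0}} (hx : Countable (trclSingleton x)) :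
    ∃ l < ω₁, ModelsZFMinusP (LOver x l) := by
  obtain ⟨l, hωl, hl, hlim, h⟩ := exists_isElementarySubset hx Ordinal.omega0_lt_omega_one
  exact ⟨l, hl, modelsZFMinusP_of_isElementarySubset hx hlim hωl hl h⟩

/-! ### The notion with both properties -/

theorem realSet_injective : Function.Injective realSet := by
  have key : ∀ (A : Set ℕ) (n : ℕ), Ordinal.toZFSet (n : Ordinal.{0}) ∈ realSet A ↔ n ∈ A := by
    intro A n
    rw [realSet, ZFSet.mem_range]
    constructor
    · rintro ⟨m, hm⟩
      have := Nat.cast_injective (Ordinal.toZFSet_injective hm)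
      exact this ▸ m.2
    · exact fun hn => ⟨⟨n, hn⟩, rfl⟩
  intro A B h
  ext n
  rw [← key, h, key]

theorem degreeSet_injective : Function.Injective degreeSet := by
  intro d e h
  obtain ⟨A, rfl⟩ := Quotient.exists_rep d
  have hA : realSet A ∈ degreeSet (Degree.of A) := ZFSet.mem_range.2 ⟨⟨A, rfl⟩, rfl⟩
  obtain ⟨⟨B, hB⟩, hBA⟩ := ZFSet.mem_range.1 ((congrArg (realSet A ∈ ·) h).mp hA)
  obtain rfl : B = A := realSet_injective hBA
  exact hB

theorem DegSeq.toSet_injective : Function.Injective DegSeq.toSet := by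
  have key : ∀ S T : DegSeq, S.toSet = T.toSet → ∀ i : Set.Iio S.length,
      ∃ j : Set.Iio T.length, j.1 = i.1 ∧ T.term j = S.term i := by
    intro S T h i
    have hi : ZFSet.pair (Ordinal.toZFSet i.1) (degreeSet (S.term i)) ∈ S.toSet :=
      ZFSet.mem_range.2 ⟨i, rfl⟩
    rw [h] at hi
    obtain ⟨j, hj⟩ := ZFSet.mem_range.1 hi
    obtain ⟨h1, h2⟩ := ZFSet.pair_inj.1 hj
    exact ⟨j, Ordinal.toZFSet_injective h1, degreeSet_injective h2⟩
  intro S T h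
  have hlen : S.length = T.length := by
    refine eq_of_forall_lt_iff fun β => ⟨fun hβ => ?_, fun hβ => ?_⟩
    · obtain ⟨j, hj, -⟩ := key S T h ⟨β, hβ⟩
      exact hj.symm.trans_lt j.2
    · obtain ⟨j, hj, -⟩ := key T S h.symm ⟨β, hβ⟩
      exact hj.symm.trans_lt j.2
  have key' := key S T h
  clear h key
  obtain ⟨α, hα, s⟩ := S
  obtain ⟨β, hβ, t⟩ := T
  obtain rfl : α = β := hlen
  have : s = t := by
    funext i
    obtain ⟨j, hj, hji⟩ := key' i
    obtain rfl : j = i := Subtype.ext hj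
    exact hji.symm
  rw [this]

/-- A sequence is determined by its last element and the initial segment before it. -/
theorem DegSeq.eq_of_restrict_eq {S T : DegSeq} {β γ : Ordinal.{0}} (hβ : β < S.length)
    (hγ : γ < T.length) (hS : S.length = β + 1) (hT : T.length = γ + 1)
    (h : S.restrict β hβ.le = T.restrict γ hγ.le) (hd : S.term ⟨β, hβ⟩ = T.term ⟨γ, hγ⟩) :
    S = T := by
  obtain ⟨α, hα, s⟩ := S
  obtain ⟨α', hα', t⟩ := T
  obtain rfl : β = γ := congrArg DegSeq.length h
  obtain rfl : α = β + 1 := hS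
  obtain rfl : α' = β + 1 := hT
  have hst : (fun i : Set.Iio β => s ⟨i.1, i.2.trans hβ⟩) =
      fun i : Set.Iio β => t ⟨i.1, i.2.trans hβ⟩ := by
    simpa only [DegSeq.restrict, DegSeq.mk.injEq, heq_eq_eq, true_and] using h
  have : s = t := by
    funext i
    rcases (Order.lt_add_one_iff.1 (Set.mem_Iio.1 i.2)).lt_or_eq with hi | hi
    · exact congrFun hst ⟨i.1, hi⟩
    · obtain rfl : i = ⟨β, hβ⟩ := Subtype.ext hi
      exact hd
  rw [this]

/-- The sequence `S` has last element `d`, which bounds the degree assigned by `h` to the part of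
`S` before it. -/
def HasCodingLast (h : DegSeq → Degree) (S : DegSeq) (d : Degree) : Prop :=
  ∃ (β : Ordinal.{0}) (hβ : β < S.length), S.length = β + 1 ∧ S.term ⟨β, hβ⟩ = d ∧
    h (S.restrict β hβ.le) ≤ d

/-- Such a sequence is recovered from `d` and the part before it, whose code is below `d`; only
countably many parts qualify. -/
theorem countable_setOf_hasCodingLast {h : DegSeq → Degree} (hh : ∀ d, {S | h S ≤ d}.Countable)
    (d : Degree) : {S | HasCodingLast h S d}.Countable := by
  have : Countable {S | h S ≤ d} := (hh d).to_subtype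
  choose β hβ hlen hlast hcode using fun S : {S | HasCodingLast h S d} => S.2
  refine Set.countable_coe_iff.1 (Function.Injective.countable
    (f := fun S => (⟨S.1.restrict (β S) (hβ S).le, hcode S⟩ : {S | h S ≤ d}))
    fun S T hST => Subtype.ext ?_)
  exact DegSeq.eq_of_restrict_eq (hβ S) (hβ T) (hlen S) (hlen T) (congrArg Subtype.val hST)
    ((hlast S).trans (hlast T).symm)

theorem HasCodingLast.unique {h : DegSeq → Degree} {S : DegSeq} {d e : Degree}
    (hd : HasCodingLast h S d) (he : HasCodingLast h S e) : d = e := by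
  obtain ⟨β, hβ, hlen, rfl, -⟩ := hd
  obtain ⟨γ, hγ, hlen', rfl, -⟩ := he
  obtain rfl : β = γ := Order.succ_injective (hlen.symm.trans hlen')
  rfl

/-- The reflexive transitive closure of a relation with countable sets of predecessors has
countable sets of predecessors. -/
theorem countable_setOf_reflTransGen {α : Type*} {r : α → α → Prop}
    (hr : ∀ b, {a | r a b}.Countable) (b : α) : {a | Relation.ReflTransGen r a b}.Countable := by
  let s : ℕ → Set α := fun n => Nat.rec {b} (fun _ t => ⋃ c ∈ t, {a | r a c}) n
  have hs : ∀ n, (s n).Countable := by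
    intro n
    induction n with
    | zero => exact Set.countable_singleton b
    | succ n ih => exact ih.biUnion fun c _ => hr c
  have key : ∀ a, Relation.ReflTransGen r a b → a ∈ ⋃ n, s n := by
    intro a ha
    induction ha using Relation.ReflTransGen.head_induction_on with
    | refl => exact Set.mem_iUnion.2 ⟨0, rfl⟩
    | head hab _ ih =>
      obtain ⟨n, hn⟩ := Set.mem_iUnion.1 ih
      exact Set.mem_iUnion.2 ⟨n + 1, Set.mem_biUnion hn hab⟩
  exact (Set.countable_iUnion hs).mono key

/-- A notion can be made stricter so as to be monotone along a relation with countable sets of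
predecessors, while its values are cut down to cones. -/
theorem FastNotion.exists_stricter_monotone (g : FastNotion) (h : DegSeq → Degree)
    {r : DegSeq → DegSeq → Prop} (hr : ∀ S, {T | r T S}.Countable) :
    ∃ f : FastNotion, f.Stricter g ∧ (∀ S, ∀ d ∈ f.next S, h S ≤ d) ∧
      ∀ S T, r T S → f.next S ⊆ f.next T := by
  -- The closure is transitive, so a predecessor of `S` imposes a subset of the constraints that `S`
  -- imposes.
  refine ⟨⟨fun S => {d | ∀ T, Relation.ReflTransGen r T S → d ∈ g.next T ∧ h T ≤ d},
    fun S => ?_, fun S d e hde hd T hT => ?_⟩, fun S d hd => (hd S .refl).1,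
    fun S d hd => (hd S .refl).2, fun S T hT d hd U hU => hd U (hU.tail hT)⟩
  · have : Countable {T | Relation.ReflTransGen r T S} :=
      (countable_setOf_reflTransGen hr S).to_subtype
    choose k hk using g.nonempty
    obtain ⟨d, hd⟩ := Degree.exists_upper_bound
      fun T : {T | Relation.ReflTransGen r T S} => k T.1
    obtain ⟨e, he⟩ := Degree.exists_upper_bound
      fun T : {T | Relation.ReflTransGen r T S} => h T.1
    obtain ⟨u, hu⟩ := Degree.exists_upper_bound fun b : Bool => cond b d e
    exact ⟨u, fun T hT => ⟨g.isUpperSet T ((hd ⟨T, hT⟩).trans (hu true)) (hk T),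
      (he ⟨T, hT⟩).trans (hu false)⟩⟩
  · exact ⟨g.isUpperSet T hde (hd T hT).1, (hd T hT).2.trans hde⟩

/-- The bound `δ < ω₁` is what makes the level over `S` countable. -/
theorem exists_isLeast_modelsZFMinusP (S : DegSeq) :
    ∃ δ < ω₁, IsLeast {ε : Ordinal.{0} | ModelsZFMinusP (LOver S.toSet ε)} δ := by
  obtain ⟨l, hl, hM⟩ := exists_modelsZFMinusP_LOver (countable_trclSingleton_toSet S)
  obtain ⟨δ, hδ⟩ : ∃ δ, IsLeast {ε : Ordinal.{0} | ModelsZFMinusP (LOver S.toSet ε)} δ :=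
    ⟨_, isLeast_csInf ⟨l, hM⟩⟩
  exact ⟨δ, (hδ.2 hM).trans_lt hl, hδ⟩

end FastGrowing
end

theorem proposition2 (g : FastGrowing.FastNotion) :
    ∃ f : FastGrowing.FastNotion, f.Stricter g ∧
      (∀ (S T : FastGrowing.DegSeq) (d : FastGrowing.Degree),
        S.HasLast d → T.HasLast d → f.Admissible S → f.Admissible T → f.next S = f.next T) ∧
      (∀ S : FastGrowing.DegSeq, ∃ δ : Ordinal.{0},
        IsLeast {ε : Ordinal.{0} |
          FastGrowing.ModelsZFMinusP (FastGrowing.LOver S.toSet ε)} δ ∧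
        ∀ T : FastGrowing.DegSeq, T.toSet ∈ FastGrowing.LOver S.toSet δ →
          f.next S ⊆ f.next T) := by
  open FastGrowing in
  obtain ⟨h, hh⟩ := exists_codeDegree
  choose δ hδ hleast using exists_isLeast_modelsZFMinusP
  -- The second alternative refers to `h` instead of admissibility for `f`, which is yet to be
  -- constructed from `r`; this avoids circularity.
  let r : DegSeq → DegSeq → Prop := fun T S =>
    T.toSet ∈ LOver S.toSet (δ S) ∨ ∃ d, HasCodingLast h T d ∧ HasCodingLast h S d
  have hr : ∀ S, {T | r T S}.Countable := by
    intro S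
    have hc := countable_LOver (countable_trclSingleton_toSet S) (hδ S)
    refine Set.Countable.union ?_ ?_
    · exact (Set.countable_coe_iff.1 hc).preimage_of_injOn (f := DegSeq.toSet)
        DegSeq.toSet_injective.injOn
    · by_cases hS : ∃ d, HasCodingLast h S d
      · obtain ⟨d, hd⟩ := hS
        refine (countable_setOf_hasCodingLast hh d).mono ?_
        rintro T ⟨e, hT, he⟩
        rwa [hd.unique he]
      · refine Set.countable_empty.mono ?_
        rintro T ⟨e, -, he⟩
        exact hS ⟨e, he⟩
  obtain ⟨f, hfg, hfh, hmono⟩ := g.exists_stricter_monotone h hr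
  have hcode : ∀ (S : DegSeq) (d : Degree), S.HasLast d → f.Admissible S →
      HasCodingLast h S d := by
    rintro S d ⟨β, hβ, hlen, rfl⟩ hS
    -- Admissibility at the last index `β` puts the last element in `f.next` of the part before it,
    -- hence above the code of that part.
    exact ⟨β, hβ, hlen, rfl, hfh _ _ (hS β hβ)⟩
  refine ⟨f, hfg, fun S T d hSd hTd hS hT => ?_, fun S => ⟨δ S, hleast S, fun T hT => ?_⟩⟩
  · have h1 := hcode S d hSd hS
    have h2 := hcode T d hTd hT
    -- The second alternative of `r` is symmetric, so monotonicity gives both inclusions.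
    exact (hmono S T (.inr ⟨d, h2, h1⟩)).antisymm (hmono T S (.inr ⟨d, h1, h2⟩))
  · exact hmono S T (.inl hT)
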